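/- Let $G$ be a locally compact second countable (Hausdorff) topological group. For a group $H$ ($H=G$ with its Borel structure, or a countable subgroup of $G$), an $H$-space is a standard Borel probability space $(X,\nu)$ with a Borel action of $H$ under which $\nu$ is quasi-invariant; an $H$-map $\pi:(X,\nu)\to(Y,\eta)$ of $H$-spaces is a measurable map with $\pi_*\nu=\eta$ such that, for every $h\in H$, $\pi(hx)=h\pi(x)$ for $\nu$-almost every $x$. A disintegration of $\nu$ over $\eta$ via $\pi$ is a Borel map $D:Y\to P(X)$ such that $D(y)$ is carried by $\pi^{-1}(y)$ for $\eta$-almost every $y$ and $\int_Y D(y)\,d\eta(y)=\nu$ (it exists and is unique up to $\eta$-null sets). Put $D^{(h)}(y)=h^{-1}D(hy)$, that is, $D^{(h)}(y)(B)=D(hy)(hB)$. The $H$-map $\pi$ is relatively contractive if for every version $D$ of the disintegration, for $\eta$-almost every $y\in Y$ and every measurable $B\subseteq X$ with $D(y)(B)>0$, one has $\sup_{h\in H}D^{(h)}(y)(B)=1$. Theorem. Let $\pi:(X,\nu)\to(Y,\eta)$ be a relatively contractive $G$-map of $G$-spaces, and let $G_0$ be a countable dense subgroup of $G$. Then, for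 the restricted actions, $\pi$ is a relatively contractive $G_0$-map of $G_0$-spaces. -/

import Mathlib

open MeasureTheory ProbabilityTheory

namespace GroupAction

/-- `(X, ν)` is a `G`-space: a standard Borel probability space with a Borel action of `G` under
which `ν` is quasi-invariant (the class of null sets is preserved by every element of `G`). -/
structure IsGSpace (G : Type*) {X : Type*} [Group G] [MeasurableSpace G] [MeasurableSpace X]
    [MulAction G X] (ν : Measure X) : Prop where
  standardBorel : StandardBorelSpace X
  isProbabilityMeasure : IsProbabilityMeasure ν
  measurable_smul : Measurable (fun p : G × X => p.1 • p.2)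
  quasiInvariant : ∀ (g : G) (s : Set X), MeasurableSet s →
    (ν ((fun x => g • x) ⁻¹' s) = 0 ↔ ν s = 0)

/-- `π : (X, ν) → (Y, η)` is a `G`-map of `G`-spaces: measurable, `π_* ν = η`, and for all `g`,
`π (g x) = g π x` for almost every `x`. -/
structure IsGMap (G : Type*) {X Y : Type*} [Group G] [MeasurableSpace G]
    [MeasurableSpace X] [MulAction G X] [MeasurableSpace Y] [MulAction G Y]
    (π : X → Y) (ν : Measure X) (η : Measure Y) : Prop where
  source : IsGSpace G ν
  target : IsGSpace G η
  measurable : Measurable π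
  map_eq : ν.map π = η
  equivariant : ∀ g : G, ∀ᵐ x ∂ν, π (g • x) = g • π x

/-- The Borel map `D : Y → P(X)` (a Markov kernel) is a disintegration of `ν` over `η` via `π`:
`D y` is carried by the fibre `π⁻¹(y)` for almost every `y`, and `∫ D y dη(y) = ν`. -/
structure IsDisintegration {X Y : Type*} [MeasurableSpace X] [MeasurableSpace Y]
    (π : X → Y) (ν : Measure X) (η : Measure Y) (D : Kernel Y X) : Prop where
  isMarkovKernel : IsMarkovKernel D
  fibre : ∀ᵐ y ∂η, D y (π ⁻¹' {y})ᶜ = 0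
  bind_eq : η.bind D = ν

/-- The conjugated disintegration measure `D^(g)(y) = g⁻¹ D(g y)`. -/
noncomputable def conjDisintegration {G X Y : Type*} [Group G]
    [MeasurableSpace X] [MulAction G X] [MeasurableSpace Y] [MulAction G Y]
    (D : Kernel Y X) (g : G) (y : Y) : Measure X :=
  (D (g • y)).map (fun x => g⁻¹ • x)

/-- `π : (X, ν) → (Y, η)` is a relatively contractive `G`-map of `G`-spaces: for almost every `y`
and every measurable `B` with `D y B > 0` one has `sup_g D^(g)(y)(B) = 1`.

A disintegration is only determined up to null sets, and for an uncountable group the orbit of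
almost every point may meet a given null set, so that the displayed condition for a single
version `D` depends on the version. It is therefore required of every version. -/
structure IsRelativelyContractive (G : Type*) {X Y : Type*} [Group G] [MeasurableSpace G]
    [MeasurableSpace X] [MulAction G X] [MeasurableSpace Y] [MulAction G Y]
    (π : X → Y) (ν : Measure X) (η : Measure Y) : Prop where
  isGMap : IsGMap G π ν η
  contractive : ∀ D : Kernel Y X, IsDisintegration π ν η D →
    ∀ᵐ y ∂η, ∀ B : Set X, MeasurableSet B → 0 < D y B →
      ⨆ g : G, conjDisintegration D g y B = 1

end GroupAction

open Filter Topology Pointwise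
open scoped ENNReal

/-! Fix a version `D`. It suffices to find another version `D'` such that, for almost every `y`,
every conjugate of `D'` over `G` is bounded on each measurable `B` by the supremum over `G₀` of the
conjugates of `D`: contractivity over `G`, applied to `D'`, then forces that supremum to be 1.

For almost every `y`, Haar-almost all conjugates at `y` are absolutely continuous with respect to `D
y`, hence form a family separable in total variation. `G₀` acts ergodically on `G` by left
translation (Steinhaus), so along almost every `G₀`-orbit the conjugates are dense in the essential
range of the family. Fubini and quasi-invariance carry this to almost every `y`
(`IsGMap.ae_essentialRange_conjDisintegration`). On the exceptional null set `N`, which orbits of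
good points may still meet, `D` is replaced by its Haar-type average over conjugates; the average
inherits any upper bound valid for almost every group element. -/

namespace GroupAction

/-! ### Ergodicity of a countable dense subgroup acting by translation. -/

section DenseSubgroup

variable {G : Type*} [Group G] [TopologicalSpace G] [IsTopologicalGroup G]
    [LocallyCompactSpace G] [SecondCountableTopology G] [MeasurableSpace G] [BorelSpace G]

/-- For non-null measurable sets `E` and `F`, some left translate of `F` meets `E` in a non-null
set. -/
lemma exists_measure_preimage_mul_inter_ne_zero (lam : Measure G) [lam.IsHaarMeasure]
    {E F : Set G} (hE : MeasurableSet E) (hF : MeasurableSet F) (hE0 : lam E ≠ 0)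
    (hF0 : lam F ≠ 0) : ∃ g : G, lam ((fun x => g * x) ⁻¹' E ∩ F) ≠ 0 := by
  by_contra! hcon
  have h1 : ∀ᵐ g ∂lam, ∀ᵐ x ∂lam, ¬ (g * x ∈ E ∧ x ∈ F) :=
    Eventually.of_forall fun g => by
      rw [ae_iff]
      simp only [not_not]
      exact hcon g
  have hmeas : MeasurableSet {p : G × G | ¬ (p.1 * p.2 ∈ E ∧ p.2 ∈ F)} :=
    ((measurable_mul hE).inter (measurable_snd hF)).compl
  -- By Fubini, some `x ∈ F` has only a null set of `g` with `g * x ∈ E`. That set is a right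
  -- translate of `E`, and right translations preserve Haar-null sets.
  rw [Measure.ae_ae_comm hmeas] at h1
  have hfr : ∃ᶠ x in ae lam, x ∈ F := by rwa [frequently_ae_mem_iff]
  obtain ⟨x, hxF, hx⟩ := (hfr.and_eventually h1).exists
  have h2 : lam ((fun g => g * x) ⁻¹' E) = 0 := by
    rw [ae_iff] at hx
    simp only [hxF, and_true, not_not] at hx
    exact hx
  have h3 := (quasiMeasurePreserving_mul_right lam x⁻¹).preimage_null h2
  apply hE0
  simpa [Set.preimage_preimage] using h3

/-- Almost every orbit of a dense subgroup meets a given non-null measurable set. -/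
lemma ae_exists_mem_subgroup_mul_mem (lam : Measure G) [lam.IsHaarMeasure] (G₀ : Subgroup G)
    (hcountable : (G₀ : Set G).Countable) (hdense : Dense (G₀ : Set G)) {E : Set G}
    (hE : MeasurableSet E) (hE0 : lam E ≠ 0) : ∀ᵐ k ∂lam, ∃ h ∈ G₀, h * k ∈ E := by
  by_contra hcon
  set F : Set G := {k | ¬ ∃ h ∈ G₀, h * k ∈ E} with hFdef
  have hF : MeasurableSet F := by
    have : F = (⋃ h ∈ (G₀ : Set G), (fun k => h * k) ⁻¹' E)ᶜ := by
      ext k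
      simp [hFdef]
    rw [this]
    exact (MeasurableSet.biUnion hcountable fun h _ => measurable_const_mul h hE).compl
  obtain ⟨g, hg⟩ := exists_measure_preimage_mul_inter_ne_zero lam hE hF hE0 hcon
  set F' := (fun x => g * x) ⁻¹' E ∩ F
  have hF' : MeasurableSet F' := (measurable_const_mul g hE).inter hF
  -- Steinhaus: some `h ∈ G₀` close to `g` satisfies `g⁻¹ * h = a / b` with `a, b ∈ F'`, so `h * b =
  -- g * a ∈ E` although `b ∈ F`.
  have hnhds : F' / F' ∈ 𝓝 (1 : G) :=
    Measure.div_mem_nhds_one_of_haar_pos lam F' hF' (pos_iff_ne_zero.2 hg)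
  have hcont : Tendsto (fun x : G => g⁻¹ * x) (𝓝 g) (𝓝 1) := by
    have := (continuous_const_mul g⁻¹).tendsto g
    simpa using this
  obtain ⟨h, hh, hhG⟩ := mem_closure_iff_nhds.1 (hdense g) _ (hcont hnhds)
  obtain ⟨a, ha, b, hb, hab⟩ := Set.mem_div.1 hh
  refine hb.2 ⟨h, hhG, ?_⟩
  have : h * b = g * a := by
    have h1 : a = g⁻¹ * h * b := by
      have hab' : a / b = g⁻¹ * h := hab
      rw [← hab', div_mul_cancel]
    rw [h1]; group
  rw [this]
  exact ha.1

end DenseSubgroup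

/-! ### Total variation closeness: measurability and separability. -/

section SetwiseWithin

variable {X : Type*} [MeasurableSpace X]

/-- The values of `μ` and `ν` on measurable sets differ by at most `ε`. -/
def SetwiseWithin (ε : ℝ≥0∞) (μ ν : Measure X) : Prop :=
  ∀ A : Set X, MeasurableSet A → μ A ≤ ν A + ε ∧ ν A ≤ μ A + ε

lemma SetwiseWithin.symm {ε : ℝ≥0∞} {μ ν : Measure X} (h : SetwiseWithin ε μ ν) :
    SetwiseWithin ε ν μ := fun A hA => (h A hA).symm

lemma SetwiseWithin.trans {ε δ : ℝ≥0∞} {μ ν ρ : Measure X} (h : SetwiseWithin ε μ ν)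
    (h' : SetwiseWithin δ ν ρ) : SetwiseWithin (ε + δ) μ ρ := fun A hA => by
  constructor
  · calc μ A ≤ ν A + ε := (h A hA).1
      _ ≤ ρ A + δ + ε := by gcongr; exact (h' A hA).1
      _ = ρ A + (ε + δ) := by ring
  · calc ρ A ≤ ν A + δ := (h' A hA).2
      _ ≤ μ A + ε + δ := by gcongr; exact (h A hA).2
      _ = μ A + (ε + δ) := by ring

lemma SetwiseWithin.map {Z : Type*} [MeasurableSpace Z] {ε : ℝ≥0∞} {μ ν : Measure X}
    (h : SetwiseWithin ε μ ν) {f : X → Z} (hf : Measurable f) :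
    SetwiseWithin ε (μ.map f) (ν.map f) := fun A hA => by
  rw [Measure.map_apply hf hA, Measure.map_apply hf hA]
  exact h _ (hf hA)

lemma measure_le_add_of_measureDense {μ ν : Measure X} [IsFiniteMeasure μ] [IsFiniteMeasure ν]
    {𝒜 : Set (Set X)} (h𝒜 : (μ + ν).MeasureDense 𝒜) {ε : ℝ≥0∞}
    (h : ∀ A ∈ 𝒜, μ A ≤ ν A + ε) {A : Set X} (hA : MeasurableSet A) : μ A ≤ ν A + ε := by
  refine ENNReal.le_of_forall_pos_le_add fun δ hδ _ => ?_
  obtain ⟨B, hB, hAB⟩ := h𝒜.approx A hA (measure_ne_top _ _) δ (by exact_mod_cast hδ)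
  have hAB' : μ (symmDiff A B) + ν (symmDiff A B) ≤ δ := by
    simpa using hAB.le
  calc μ A ≤ μ (B ∪ symmDiff A B) := measure_mono fun x hx => by
          by_cases hxB : x ∈ B
          · exact Or.inl hxB
          · exact Or.inr (Or.inl ⟨hx, hxB⟩)
    _ ≤ μ B + μ (symmDiff A B) := measure_union_le _ _
    _ ≤ ν B + ε + μ (symmDiff A B) := by gcongr; exact h B hB
    _ ≤ ν (A ∪ symmDiff A B) + ε + μ (symmDiff A B) := by
          gcongr
          intro x hx
          by_cases hxA : x ∈ A
          · exact Or.inl hxA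
          · exact Or.inr (Or.inr ⟨hx, hxA⟩)
    _ ≤ ν A + ν (symmDiff A B) + ε + μ (symmDiff A B) := by
          gcongr; exact measure_union_le _ _
    _ = ν A + ε + (μ (symmDiff A B) + ν (symmDiff A B)) := by ring
    _ ≤ ν A + ε + δ := by gcongr

/-- A countable generating algebra approximates every measurable set for both measures at once, so
countably many inequalities suffice. -/
lemma measurableSet_setwiseWithin [MeasurableSpace.CountablyGenerated X] {α : Type*}
    [MeasurableSpace α] (κ₁ κ₂ : Kernel α X) [IsFiniteKernel κ₁] [IsFiniteKernel κ₂]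
    (ε : ℝ≥0∞) : MeasurableSet {a | SetwiseWithin ε (κ₁ a) (κ₂ a)} := by
  set 𝒜 := generateSetAlgebra (MeasurableSpace.countableGeneratingSet X) with h𝒜
  have hcount : 𝒜.Countable :=
    countable_generateSetAlgebra MeasurableSpace.countable_countableGeneratingSet
  have hgen : ‹MeasurableSpace X› = MeasurableSpace.generateFrom 𝒜 := by
    rw [h𝒜, generateFrom_generateSetAlgebra_eq, MeasurableSpace.generateFrom_countableGeneratingSet]
  have hmeas : ∀ A ∈ 𝒜, MeasurableSet A := fun A hA =>
    hgen ▸ MeasurableSpace.measurableSet_generateFrom hA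
  have hset : {a | SetwiseWithin ε (κ₁ a) (κ₂ a)} =
      ⋂ A ∈ 𝒜, {a | κ₁ a A ≤ κ₂ a A + ε} ∩ {a | κ₂ a A ≤ κ₁ a A + ε} := by
    ext a
    simp only [Set.mem_iInter, Set.mem_inter_iff, Set.mem_ofPred_eq]
    refine ⟨fun h A hA => h A (hmeas A hA), fun h A hA => ⟨?_, ?_⟩⟩
    · exact measure_le_add_of_measureDense
        (Measure.MeasureDense.of_generateFrom_isSetAlgebra_finite _
          isSetAlgebra_generateSetAlgebra hgen) (fun A hA => (h A hA).1) hA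
    · exact measure_le_add_of_measureDense
        (Measure.MeasureDense.of_generateFrom_isSetAlgebra_finite _
          isSetAlgebra_generateSetAlgebra hgen) (fun A hA => (h A hA).2) hA
  rw [hset]
  refine MeasurableSet.biInter hcount fun A hA => ?_
  have h1 := κ₁.measurable_coe (hmeas A hA)
  have h2 := κ₂.measurable_coe (hmeas A hA)
  exact (measurableSet_le h1 (h2.add_const _)).inter (measurableSet_le h2 (h1.add_const _))

/-- A family of finite measures absolutely continuous with respect to a fixed one is separable in
total variation. -/
lemma exists_countable_setwiseWithin [MeasurableSpace.CountablyGenerated X] {ι : Type*}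
    (κ : ι → Measure X) [∀ i, IsFiniteMeasure (κ i)] (μ : Measure X) [IsFiniteMeasure μ]
    {S : Set ι} (hS : ∀ i ∈ S, κ i ≪ μ) :
    ∃ C : Set ι, C.Countable ∧ ∀ i ∈ S, ∀ ε ≠ 0, ∃ c ∈ C, SetwiseWithin ε (κ i) (κ c) := by
  have hint : ∀ i, Integrable (fun x => ((κ i).rnDeriv μ x).toReal) μ :=
    fun i => Measure.integrable_toReal_rnDeriv
  have key : ∀ i ∈ S, ∀ j ∈ S, ∀ A, MeasurableSet A →
      κ i A ≤ κ j A + edist ((hint i).toL1 _) ((hint j).toL1 _) := by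
    intro i hi j hj A hA
    rw [Integrable.edist_toL1_toL1, ← Measure.setLIntegral_rnDeriv (hS i hi) A,
      ← Measure.setLIntegral_rnDeriv (hS j hj) A]
    refine le_trans ?_ (add_le_add_right (setLIntegral_le_lintegral A _) _)
    rw [← lintegral_add_left (Measure.measurable_rnDeriv _ _)]
    refine lintegral_mono_ae (ae_restrict_of_ae ?_)
    filter_upwards [(κ i).rnDeriv_ne_top μ, (κ j).rnDeriv_ne_top μ] with x hx hy
    rw [edist_dist, ← ENNReal.ofReal_toReal hx, ← ENNReal.ofReal_toReal hy,
      ← ENNReal.ofReal_add ENNReal.toReal_nonneg dist_nonneg]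
    apply ENNReal.ofReal_le_ofReal
    rw [ENNReal.toReal_ofReal ENNReal.toReal_nonneg, ENNReal.toReal_ofReal ENNReal.toReal_nonneg,
      Real.dist_eq]
    linarith [le_abs_self (((κ i).rnDeriv μ x).toReal - ((κ j).rnDeriv μ x).toReal)]
  -- By `key`, the `L¹` distance of densities controls the setwise distance; separability is
  -- inherited from `L¹(μ)` through the induced pseudometric.
  let F : S → Lp ℝ 1 μ := fun i => (hint i).toL1 _
  have : Fact ((1 : ℝ≥0∞) ≠ ∞) := ⟨ENNReal.one_ne_top⟩
  let : PseudoEMetricSpace S := PseudoEMetricSpace.induced F inferInstance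
  have : SecondCountableTopology S := TopologicalSpace.secondCountableTopology_induced S _ F
  obtain ⟨C, hC, hCd⟩ := TopologicalSpace.exists_countable_dense S
  refine ⟨Subtype.val '' C, hC.image _, fun i hi ε hε => ?_⟩
  obtain ⟨c, hcC, hc⟩ := EMetric.mem_closure_iff.1 (hCd ⟨i, hi⟩) ε (pos_iff_ne_zero.2 hε)
  refine ⟨c, ⟨c, hcC, rfl⟩, fun A hA => ⟨?_, ?_⟩⟩
  · exact (key i hi c c.2 A hA).trans (by gcongr; exact hc.le)
  · refine (key c c.2 i hi A hA).trans ?_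
    gcongr
    rw [edist_comm]
    exact hc.le

end SetwiseWithin

/-! ### Essential range of a kernel on the group. -/

section EssentialRange

variable {G X : Type*} [Group G] [TopologicalSpace G] [IsTopologicalGroup G]
    [LocallyCompactSpace G] [SecondCountableTopology G] [MeasurableSpace G] [BorelSpace G]
    [MeasurableSpace X] [MeasurableSpace.CountablyGenerated X]

/-- For a kernel from `G` with values absolutely continuous with respect to a fixed measure, almost
every value lies in the essential range, and almost every orbit of a dense subgroup has values dense
in the essential range. -/
lemma ae_essentialRange (lam : Measure G) [lam.IsHaarMeasure] (G₀ : Subgroup G)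
    (hcountable : (G₀ : Set G).Countable) (hdense : Dense (G₀ : Set G))
    (κ : Kernel G X) [IsFiniteKernel κ] (μ : Measure X) [IsFiniteMeasure μ]
    (hκ : ∀ᵐ k ∂lam, κ k ≪ μ) (ε : ℝ≥0∞) (hε : ε ≠ 0) :
    ∀ᵐ k₀ ∂lam, (∃ᶠ k in ae lam, SetwiseWithin ε (κ k₀) (κ k)) ∧
      ∀ᵐ k ∂lam, ∃ h ∈ G₀, SetwiseWithin ε (κ k) (κ (h * k₀)) := by
  obtain ⟨C, hC, hCS⟩ := exists_countable_setwiseWithin κ μ (S := {k | κ k ≪ μ}) fun _ h => h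
  have hε2 : ε / 2 ≠ 0 := by simpa using hε
  -- Radius `ε / 2` puts any two members of one ball within `ε`. With countably many centres, the
  -- null balls together can be discarded.
  set E : G → Set G := fun c => {k | SetwiseWithin (ε / 2) (κ k) (κ c)} with hEdef
  have hE : ∀ c, MeasurableSet (E c) := fun c =>
    measurableSet_setwiseWithin κ (Kernel.const G (κ c)) (ε / 2)
  have hgood : ∀ᵐ k ∂lam, ∃ c ∈ C, k ∈ E c ∧ lam (E c) ≠ 0 := by
    have hnull : ∀ᵐ k ∂lam, ∀ c ∈ C, lam (E c) = 0 → k ∉ E c := by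
      refine (ae_ball_iff hC).2 fun c _ => ?_
      by_cases h0 : lam (E c) = 0
      · filter_upwards [measure_eq_zero_iff_ae_notMem.1 h0] with k hk _ using hk
      · exact Eventually.of_forall fun k h => absurd h h0
    filter_upwards [hκ, hnull] with k hk hk'
    obtain ⟨c, hc, hkc⟩ := hCS k hk _ hε2
    exact ⟨c, hc, hkc, fun h0 => hk' c hc h0 hkc⟩
  have hmeet : ∀ᵐ k₀ ∂lam, ∀ c ∈ C, lam (E c) ≠ 0 → ∃ h ∈ G₀, h * k₀ ∈ E c := by
    refine (ae_ball_iff hC).2 fun c _ => ?_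
    by_cases h0 : lam (E c) = 0
    · exact Eventually.of_forall fun k h => absurd h0 h
    · filter_upwards [ae_exists_mem_subgroup_mul_mem lam G₀ hcountable hdense (hE c) h0]
        with k hk _ using hk
  filter_upwards [hgood, hmeet] with k₀ hk₀ hk₀'
  constructor
  · obtain ⟨c, -, hkc, hc0⟩ := hk₀
    refine (frequently_ae_mem_iff.2 hc0).mono fun k hk => ?_
    simpa using SetwiseWithin.trans hkc hk.symm
  · filter_upwards [hgood] with k hk
    obtain ⟨c, hc, hkc, hc0⟩ := hk
    obtain ⟨h, hh, hhc⟩ := hk₀' c hc hc0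
    exact ⟨h, hh, by simpa using SetwiseWithin.trans hkc hhc.symm⟩

end EssentialRange

/-! ### Conjugated disintegrations and their averages. -/

section Conjugation

variable {G X Y : Type*} [Group G]
    [MeasurableSpace X] [MulAction G X] [MeasurableSpace Y] [MulAction G Y]

lemma conjDisintegration_one (D : Kernel Y X) (y : Y) :
    conjDisintegration D (1 : G) y = D y := by
  simp [conjDisintegration]

lemma conjDisintegration_apply [MeasurableConstSMul G X] (D : Kernel Y X) (g : G) (y : Y)
    {B : Set X} (hB : MeasurableSet B) :
    conjDisintegration D g y B = D (g • y) ((fun x => g⁻¹ • x) ⁻¹' B) :=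
  Measure.map_apply (measurable_const_smul _) hB

lemma conjDisintegration_smul [MeasurableConstSMul G X] (D : Kernel Y X) (g k : G) (y : Y) :
    conjDisintegration D g (k • y) = (conjDisintegration D (g * k) y).map (fun x => k • x) := by
  rw [conjDisintegration, conjDisintegration,
    Measure.map_map (measurable_const_smul _) (measurable_const_smul _), smul_smul]
  congr 1
  funext x
  simp [smul_smul]

lemma map_conjDisintegration_smul [MeasurableConstSMul G X] (D : Kernel Y X) (g k : G) (y : Y) :
    (conjDisintegration D g (k • y)).map (fun x => k⁻¹ • x) = conjDisintegration D (g * k) y := by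
  rw [conjDisintegration_smul, Measure.map_map (measurable_const_smul _) (measurable_const_smul _)]
  simp [Function.comp_def]

/-- A measurable property that holds at almost every point of almost every orbit holds almost
everywhere. -/
lemma ae_of_ae_ae_smul [MeasurableSpace G] [MeasurableSMul₂ G Y] (lam : Measure G)
    [SFinite lam] [NeZero lam] (η : Measure Y) [SFinite η]
    (hη : ∀ (g : G) (s : Set Y), MeasurableSet s → (η ((fun y => g • y) ⁻¹' s) = 0 ↔ η s = 0))
    {P : Y → Prop} (hP : MeasurableSet {y | P y})
    (h : ∀ᵐ y ∂η, ∀ᵐ k ∂lam, P (k • y)) : ∀ᵐ y ∂η, P y := by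
  have hmeas : MeasurableSet {p : Y × G | P (p.2 • p.1)} :=
    (measurable_snd.smul measurable_fst) hP
  -- Fubini yields a single `k` that works for almost every `y`; quasi-invariance then removes the
  -- translation by `k`.
  rw [Measure.ae_ae_comm hmeas] at h
  obtain ⟨k, hk⟩ := h.exists
  rw [ae_iff] at hk ⊢
  exact (hη k _ hP.compl).1 hk

/-- The disintegration and the map determine the measure on the graph. -/
lemma compProd_eq_map_graph {ν : Measure X} {η : Measure Y} [SFinite η] {π : X → Y}
    (hπ : Measurable π) {D : Kernel Y X} (hD : IsDisintegration π ν η D) :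
    η ⊗ₘ D = ν.map (fun x => (π x, x)) := by
  have := hD.isMarkovKernel
  have hm : Measurable (fun x => (π x, x)) := hπ.prodMk measurable_id
  ext s hs
  rw [Measure.map_apply hm hs, Measure.compProd_apply hs]
  conv_rhs => rw [← hD.bind_eq, Measure.bind_apply (hm hs) D.aemeasurable]
  refine lintegral_congr_ae ?_
  filter_upwards [hD.fibre] with y hy
  refine measure_congr ?_
  have hy' : ∀ᵐ x ∂(D y), π x = y := by
    rw [ae_iff]
    exact hy
  filter_upwards [hy'] with x hx
  apply propext
  change (y, x) ∈ s ↔ (π x, x) ∈ s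
  rw [hx]

variable [MeasurableSpace G] [MeasurableInv G] [MeasurableSMul₂ G X] [MeasurableSMul₂ G Y]

/-- The conjugated disintegrations, as a kernel in both variables. -/
noncomputable def conjKernel (D : Kernel Y X) : Kernel (G × Y) X :=
  ((Kernel.deterministic Prod.fst measurable_fst) ×ₖ
    (D.comap (fun p : G × Y => p.1 • p.2) (measurable_fst.smul measurable_snd))).map
    (fun q : G × X => q.1⁻¹ • q.2)

lemma conjKernel_apply (D : Kernel Y X) [IsSFiniteKernel D] (p : G × Y) :
    conjKernel D p = conjDisintegration D p.1 p.2 := by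
  have hm : Measurable (fun q : G × X => q.1⁻¹ • q.2) := by fun_prop
  rw [conjKernel, Kernel.map_apply _ hm, Kernel.prod_apply, Kernel.deterministic_apply,
    Measure.dirac_prod, Kernel.comap_apply, Measure.map_map hm measurable_prodMk_left,
    conjDisintegration]
  rfl

instance (D : Kernel Y X) [IsMarkovKernel D] : IsMarkovKernel (conjKernel (G := G) D) := by
  have hm : Measurable (fun q : G × X => q.1⁻¹ • q.2) := by fun_prop
  exact Kernel.IsMarkovKernel.map _ hm

instance (D : Kernel Y X) [IsMarkovKernel D] (g : G) (y : Y) :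
    IsProbabilityMeasure (conjDisintegration D g y) := by
  rw [← conjKernel_apply D (g, y)]
  infer_instance

/-- The average of the conjugated disintegrations over a measure on the group. -/
noncomputable def averagedDisintegration (m : Measure G) (D : Kernel Y X) : Kernel Y X :=
  conjKernel (G := G) D ∘ₖ (Kernel.const Y m ×ₖ Kernel.id)

lemma averagedDisintegration_apply (m : Measure G) [SFinite m] (D : Kernel Y X)
    [IsSFiniteKernel D] (y : Y) {B : Set X} (hB : MeasurableSet B) :
    averagedDisintegration m D y B = ∫⁻ k, conjDisintegration D k y B ∂m := by
  rw [averagedDisintegration, Kernel.comp_apply' _ _ _ hB, Kernel.prod_apply, Kernel.const_apply,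
    Kernel.id_apply, Measure.prod_dirac,
    lintegral_map (Kernel.measurable_coe _ hB) measurable_prodMk_right]
  simp only [conjKernel_apply]

instance (m : Measure G) [IsProbabilityMeasure m] (D : Kernel Y X) [IsMarkovKernel D] :
    IsMarkovKernel (averagedDisintegration m D) := by
  rw [averagedDisintegration]
  infer_instance

/-- The conjugate by `k` disintegrates `k⁻¹ν` over `k⁻¹η`. Since `k⁻¹ν ≪ ν`, the graph measures are
absolutely continuous, hence so are almost all fibre measures; `η ≪ k⁻¹η` makes this hold `η`-almost
everywhere. -/
lemma IsGMap.ae_conjDisintegration_absolutelyContinuous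
    [StandardBorelSpace X] [StandardBorelSpace Y]
    {ν : Measure X} {η : Measure Y} {π : X → Y} (hπ : IsGMap G π ν η) {D : Kernel Y X}
    (hD : IsDisintegration π ν η D) (k : G) : ∀ᵐ y ∂η, conjDisintegration D k y ≪ D y := by
  have := hD.isMarkovKernel
  have := hπ.source.isProbabilityMeasure
  have := hπ.target.isProbabilityMeasure
  set Dk : Kernel Y X := (conjKernel D).comap (fun y => (k, y)) measurable_prodMk_left with hDk
  have hDk_apply : ∀ y, Dk y = conjDisintegration D k y := fun y => by
    rw [hDk, Kernel.comap_apply, conjKernel_apply]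
  have hk : Measurable (fun y : Y => k⁻¹ • y) := measurable_const_smul _
  have hkX : Measurable (fun x : X => k⁻¹ • x) := measurable_const_smul _
  have hgraph : Measurable (fun x => (π x, x)) := hπ.measurable.prodMk measurable_id
  have hν : ν.map (fun x => k⁻¹ • x) ≪ ν := Measure.AbsolutelyContinuous.mk fun s hs h0 => by
    rw [Measure.map_apply hkX hs]
    exact (hπ.source.quasiInvariant k⁻¹ s hs).2 h0
  have hη : η ≪ η.map (fun y => k⁻¹ • y) := Measure.AbsolutelyContinuous.mk fun s hs h0 => by
    rw [Measure.map_apply hk hs] at h0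
    exact (hπ.target.quasiInvariant k⁻¹ s hs).1 h0
  have hprod : (η.map (fun y => k⁻¹ • y)) ⊗ₘ Dk =
      (ν.map (fun x => k⁻¹ • x)).map (fun x => (π x, x)) := by
    have hpair : Measurable (fun p : Y × X => (k⁻¹ • p.1, k⁻¹ • p.2)) :=
      (hk.comp measurable_fst).prodMk (hkX.comp measurable_snd)
    have h1 : (η.map (fun y => k⁻¹ • y)) ⊗ₘ Dk =
        (η ⊗ₘ D).map (fun p : Y × X => (k⁻¹ • p.1, k⁻¹ • p.2)) := by
      ext s hs
      rw [Measure.map_apply hpair hs, Measure.compProd_apply hs,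
        Measure.compProd_apply (hpair hs), lintegral_map (Kernel.measurable_kernel_prodMk_left hs) hk]
      refine lintegral_congr fun y => ?_
      rw [hDk_apply, conjDisintegration_apply _ _ _ (measurable_prodMk_left hs), smul_inv_smul]
      rfl
    rw [h1, compProd_eq_map_graph hπ.measurable hD, Measure.map_map hpair hgraph,
      Measure.map_map hgraph hkX]
    refine Measure.map_congr ?_
    filter_upwards [hπ.equivariant k⁻¹] with x hx
    simp [hx]
  have hac : (η.map (fun y => k⁻¹ • y)) ⊗ₘ Dk ≪ η ⊗ₘ D := by
    rw [hprod, compProd_eq_map_graph hπ.measurable hD]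
    exact hν.map hgraph
  have := Measure.isProbabilityMeasure_map (μ := η) hk.aemeasurable
  filter_upwards [hη.ae_le hac.kernel_of_compProd] with y hy
  rwa [hDk_apply] at hy

end Conjugation

/-! ### Restriction to a subgroup and change of version. -/

section Restriction

variable {G X Y : Type*} [Group G] [MeasurableSpace G] [MeasurableSpace X] [MulAction G X]
    [MeasurableSpace Y] [MulAction G Y] {ν : Measure X} {η : Measure Y} {π : X → Y}

lemma IsGSpace.subgroup (h : IsGSpace G ν) (H : Subgroup G) : IsGSpace H ν where
  standardBorel := h.standardBorel
  isProbabilityMeasure := h.isProbabilityMeasure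
  measurable_smul :=
    h.measurable_smul.comp ((measurable_subtype_coe.comp measurable_fst).prodMk measurable_snd)
  quasiInvariant g := h.quasiInvariant g

lemma IsGMap.subgroup (h : IsGMap G π ν η) (H : Subgroup G) : IsGMap H π ν η where
  source := h.source.subgroup H
  target := h.target.subgroup H
  measurable := h.measurable
  map_eq := h.map_eq
  equivariant g := h.equivariant g

lemma IsDisintegration.congr {D D' : Kernel Y X} (hD : IsDisintegration π ν η D)
    [hD' : IsMarkovKernel D'] (h : ∀ᵐ y ∂η, D' y = D y) : IsDisintegration π ν η D' where
  isMarkovKernel := hD'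
  fibre := by
    filter_upwards [hD.fibre, h] with y hy hy'
    rwa [hy']
  bind_eq := by
    rw [← hD.bind_eq]
    ext s hs
    rw [Measure.bind_apply hs D'.aemeasurable, Measure.bind_apply hs D.aemeasurable]
    refine lintegral_congr_ae ?_
    filter_upwards [h] with y hy
    rw [hy]

end Restriction

/-! ### Construction of the modified version. -/

section Modification

variable {G X Y : Type*} [Group G] [TopologicalSpace G] [IsTopologicalGroup G]
    [LocallyCompactSpace G] [SecondCountableTopology G] [MeasurableSpace G] [BorelSpace G]
    [MeasurableSpace X] [MulAction G X] [MeasurableSMul₂ G X] [StandardBorelSpace X]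
    [MeasurableSpace Y] [MulAction G Y] [MeasurableSMul₂ G Y] [StandardBorelSpace Y]

/-- At almost every point, the disintegration lies in the essential range of its conjugates, and
the conjugates by a countable dense subgroup are dense in that essential range. -/
lemma IsGMap.ae_essentialRange_conjDisintegration (lam : Measure G) [lam.IsHaarMeasure]
    {ν : Measure X} {η : Measure Y} {π : X → Y} (hπ : IsGMap G π ν η) {D : Kernel Y X}
    (hD : IsDisintegration π ν η D) (G₀ : Subgroup G)
    (hcountable : (G₀ : Set G).Countable) (hdense : Dense (G₀ : Set G))
    (ε : ℝ≥0∞) (hε : ε ≠ 0) :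
    ∀ᵐ y ∂η, (∃ᶠ k in ae lam, SetwiseWithin ε (D y) (conjDisintegration D k y)) ∧
      ∀ᵐ k ∂lam, ∃ h ∈ G₀,
        SetwiseWithin ε (conjDisintegration D k y) (conjDisintegration D h y) := by
  have := hD.isMarkovKernel
  have := hπ.target.isProbabilityMeasure
  have hset1 : MeasurableSet
      {p : Y × G | SetwiseWithin ε (D p.1) (conjDisintegration D p.2 p.1)} := by
    have := measurableSet_setwiseWithin (D.comap (Prod.fst : Y × G → Y) measurable_fst)
      ((conjKernel (G := G) D).comap (Prod.swap : Y × G → G × Y) measurable_swap) ε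
    simpa only [Kernel.comap_apply, conjKernel_apply, Prod.fst_swap, Prod.snd_swap] using this
  have hset2 : MeasurableSet {p : Y × G | ∃ h ∈ G₀,
      SetwiseWithin ε (conjDisintegration D p.2 p.1) (conjDisintegration D h p.1)} := by
    have : {p : Y × G | ∃ h ∈ G₀,
        SetwiseWithin ε (conjDisintegration D p.2 p.1) (conjDisintegration D h p.1)} =
        ⋃ h ∈ (G₀ : Set G),
          {p | SetwiseWithin ε (conjDisintegration D p.2 p.1) (conjDisintegration D h p.1)} := by
      ext p
      simp
    rw [this]
    refine MeasurableSet.biUnion hcountable fun h _ => ?_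
    have := measurableSet_setwiseWithin
      ((conjKernel (G := G) D).comap (Prod.swap : Y × G → G × Y) measurable_swap)
      ((conjKernel (G := G) D).comap (fun p : Y × G => (h, p.1))
        (measurable_const.prodMk measurable_fst)) ε
    simpa only [Kernel.comap_apply, conjKernel_apply, Prod.fst_swap, Prod.snd_swap] using this
  refine ae_of_ae_ae_smul lam η hπ.target.quasiInvariant ?_ ?_
  · refine MeasurableSet.inter ?_ ?_
    · have := (measurable_measure_prodMk_left (ν := lam) hset1) (measurableSet_singleton 0).compl
      refine this.congr ?_
      ext y
      exact frequently_ae_iff.symm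
    · have := (measurable_measure_prodMk_left (ν := lam) hset2.compl) (measurableSet_singleton 0)
      exact this
  · have hac : ∀ᵐ y ∂η, ∀ᵐ k ∂lam, conjDisintegration D k y ≪ D y := by
      have hmeas : MeasurableSet {p : G × Y | conjDisintegration D p.1 p.2 ≪ D p.2} := by
        have := Kernel.measurableSet_absolutelyContinuous (conjKernel (G := G) D)
          (D.comap (Prod.snd : G × Y → Y) measurable_snd)
        simpa only [Kernel.comap_apply, conjKernel_apply] using this
      exact (Measure.ae_ae_comm hmeas).1
        (Eventually.of_forall (hπ.ae_conjDisintegration_absolutelyContinuous hD))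
    filter_upwards [hac] with y hy
    set κ : Kernel G X := (conjKernel D).comap (fun k => (k, y)) measurable_prodMk_right with hκdef
    have hκ : ∀ k, κ k = conjDisintegration D k y := fun k => by
      rw [hκdef, Kernel.comap_apply, conjKernel_apply]
    filter_upwards [ae_essentialRange lam G₀ hcountable hdense κ (D y)
      (by simpa only [hκ] using hy) ε hε] with k₀ hk₀
    simp only [hκ] at hk₀
    have hk₀m : Measurable (fun x : X => k₀ • x) := measurable_const_smul _
    -- The conjugate by `k` at `k₀ • y` is the `k₀`-translate of the conjugate by `k * k₀` at `y`,
    -- so both claims transfer by right translation on `G`.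
    have hqmp := quasiMeasurePreserving_mul_right lam k₀⁻¹
    have hqmp' := quasiMeasurePreserving_mul_right lam k₀
    constructor
    · intro hcon
      refine hk₀.1 ?_
      filter_upwards [hqmp.ae hcon] with k hk hk'
      apply hk
      rw [conjDisintegration_smul, inv_mul_cancel_right]
      have hone := conjDisintegration_smul D 1 k₀ y
      rw [conjDisintegration_one, one_mul] at hone
      rw [hone]
      exact hk'.map hk₀m
    · filter_upwards [hqmp'.ae hk₀.2] with k ⟨h, hh, hkh⟩
      refine ⟨h, hh, ?_⟩
      rw [conjDisintegration_smul, conjDisintegration_smul]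
      exact hkh.map hk₀m

/-- There is a version of the disintegration all of whose conjugates by the group are bounded by
the supremum of the conjugates of the given version by a countable dense subgroup. -/
lemma IsGMap.exists_isDisintegration_conjDisintegration_le
    {ν : Measure X} {η : Measure Y} {π : X → Y} (hπ : IsGMap G π ν η) {D : Kernel Y X}
    (hD : IsDisintegration π ν η D) (G₀ : Subgroup G)
    (hcountable : (G₀ : Set G).Countable) (hdense : Dense (G₀ : Set G)) :
    ∃ D' : Kernel Y X, IsDisintegration π ν η D' ∧ (∀ᵐ y ∂η, D' y = D y) ∧
      ∀ᵐ y ∂η, ∀ (g : G) (B : Set X), MeasurableSet B →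
        conjDisintegration D' g y B ≤ ⨆ h : G₀, conjDisintegration D h y B := by
  classical
  have := hD.isMarkovKernel
  obtain ⟨lam, _⟩ : ∃ lam : Measure G, lam.IsHaarMeasure := ⟨Measure.haar, inferInstance⟩
  set m : Measure G := lam.toFinite with hm
  -- For `n = 0` the tolerance is `∞`, which is harmless.
  have hgood : ∀ᵐ y ∂η, ∀ n : ℕ,
      (∃ᶠ k in ae lam, SetwiseWithin (n : ℝ≥0∞)⁻¹ (D y) (conjDisintegration D k y)) ∧
      ∀ᵐ k ∂lam, ∃ h ∈ G₀, SetwiseWithin (n : ℝ≥0∞)⁻¹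
        (conjDisintegration D k y) (conjDisintegration D h y) :=
    ae_all_iff.2 fun n => hπ.ae_essentialRange_conjDisintegration lam hD G₀ hcountable hdense _
      (ENNReal.inv_ne_zero.2 (ENNReal.natCast_ne_top n))
  obtain ⟨N, hNsub, hNmeas, hN⟩ := exists_measurable_superset_of_null (ae_iff.1 hgood)
  have hNgood : ∀ y ∉ N, ∀ n : ℕ,
      (∃ᶠ k in ae lam, SetwiseWithin (n : ℝ≥0∞)⁻¹ (D y) (conjDisintegration D k y)) ∧
      ∀ᵐ k ∂lam, ∃ h ∈ G₀, SetwiseWithin (n : ℝ≥0∞)⁻¹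
        (conjDisintegration D k y) (conjDisintegration D h y) := fun y hy => by
    by_contra hcon
    exact hy (hNsub hcon)
  have hNae : ∀ᵐ y ∂η, y ∉ N := measure_eq_zero_iff_ae_notMem.1 hN
  let D' : Kernel Y X := Kernel.piecewise hNmeas (averagedDisintegration m D) D
  have hD'N : ∀ y ∈ N, D' y = averagedDisintegration m D y := fun y hy => by
    simp [D', Kernel.piecewise_apply, hy]
  have hD' : ∀ y ∉ N, D' y = D y := fun y hy => by
    simp [D', Kernel.piecewise_apply, hy]
  have heq : ∀ᵐ y ∂η, D' y = D y := by
    filter_upwards [hNae] with y hy using hD' y hy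
  refine ⟨D', hD.congr heq, heq, ?_⟩
  filter_upwards [hNae] with y hy g B hB
  have hess : ∀ᵐ k ∂lam, conjDisintegration D k y B ≤ ⨆ h : G₀, conjDisintegration D h y B := by
    filter_upwards [ae_all_iff.2 fun n => (hNgood y hy n).2] with k hk
    refine ENNReal.le_of_forall_pos_le_add fun δ hδ _ => ?_
    obtain ⟨n, hn⟩ := ENNReal.exists_inv_nat_lt (a := (δ : ℝ≥0∞)) (by exact_mod_cast hδ.ne')
    obtain ⟨h, hh, hkh⟩ := hk n
    calc conjDisintegration D k y B ≤ conjDisintegration D h y B + (n : ℝ≥0∞)⁻¹ := (hkh B hB).1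
      _ ≤ (⨆ h : G₀, conjDisintegration D h y B) + δ := by
        gcongr
        exact le_iSup (fun h : G₀ => conjDisintegration D h y B) ⟨h, hh⟩
  have hess' : ∀ᵐ k ∂lam, conjDisintegration D (k * g) y B ≤
      ⨆ h : G₀, conjDisintegration D h y B :=
    (quasiMeasurePreserving_mul_right lam g).ae hess
  set B' : Set X := (fun x => g⁻¹ • x) ⁻¹' B with hB'def
  have hgm : Measurable (fun x : X => g⁻¹ • x) := measurable_const_smul _
  have hB' : MeasurableSet B' := hgm hB
  have hconj : ∀ k : G, conjDisintegration D k (g • y) B' = conjDisintegration D (k * g) y B :=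
    fun k => by rw [← map_conjDisintegration_smul, Measure.map_apply hgm hB]
  rw [conjDisintegration_apply _ _ _ hB]
  -- On `N` the bound `hess'` is integrated against the probability measure `m`. Off `N`, `D (g •
  -- y)` is close to conjugates for a non-null set of `k`, and `hess'` bounds one of these.
  by_cases hgy : g • y ∈ N
  · rw [hD'N _ hgy, averagedDisintegration_apply _ _ _ hB']
    calc ∫⁻ k, conjDisintegration D k (g • y) B' ∂m
        ≤ ∫⁻ _, (⨆ h : G₀, conjDisintegration D h y B) ∂m := by
          refine lintegral_mono_ae ((toFinite_absolutelyContinuous lam).ae_le ?_)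
          filter_upwards [hess'] with k hk
          rwa [hconj]
      _ = _ := by simp
  · rw [hD' _ hgy]
    refine ENNReal.le_of_forall_pos_le_add fun δ hδ _ => ?_
    obtain ⟨n, hn⟩ := ENNReal.exists_inv_nat_lt (a := (δ : ℝ≥0∞)) (by exact_mod_cast hδ.ne')
    obtain ⟨k, hk, hk'⟩ := ((hNgood _ hgy n).1.and_eventually hess').exists
    calc D (g • y) B' ≤ conjDisintegration D k (g • y) B' + (n : ℝ≥0∞)⁻¹ := (hk B' hB').1
      _ ≤ (⨆ h : G₀, conjDisintegration D h y B) + δ := by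
        rw [hconj]
        gcongr

end Modification

end GroupAction

theorem theoremT {G X Y : Type*}
    [Group G] [TopologicalSpace G] [IsTopologicalGroup G] [T2Space G]
    [LocallyCompactSpace G] [SecondCountableTopology G] [MeasurableSpace G] [BorelSpace G]
    [MeasurableSpace X] [MulAction G X] [MeasurableSpace Y] [MulAction G Y]
    (ν : Measure X) (η : Measure Y) (π : X → Y)
    (hπ : GroupAction.IsRelativelyContractive G π ν η)
    (G₀ : Subgroup G) (hcountable : (G₀ : Set G).Countable) (hdense : Dense (G₀ : Set G)) :
    GroupAction.IsRelativelyContractive G₀ π ν η := by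
  refine ⟨hπ.isGMap.subgroup G₀, fun D hD => ?_⟩
  have := hπ.isGMap.source.standardBorel
  have := hπ.isGMap.target.standardBorel
  have : MeasurableSMul₂ G X := ⟨hπ.isGMap.source.measurable_smul⟩
  have : MeasurableSMul₂ G Y := ⟨hπ.isGMap.target.measurable_smul⟩
  have := hD.isMarkovKernel
  obtain ⟨D', hD', heq, hle⟩ := hπ.isGMap.exists_isDisintegration_conjDisintegration_le hD G₀
    hcountable hdense
  filter_upwards [hπ.contractive D' hD', heq, hle] with y hy hyeq hyle B hB hpos
  refine le_antisymm (iSup_le fun h => ?_) ?_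
  · exact prob_le_one (μ := GroupAction.conjDisintegration D (h : G) y)
  · rw [← hy B hB (by rwa [hyeq])]
    exact iSup_le fun g => hyle g B hB
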